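/- A probabilistic weighted automaton over a finite alphabet $\Sigma$ consists of a finite set $Q$ of states, an initial probability distribution $\rho_I$ on $Q$, a probability distribution $\delta(q,\sigma)$ on $Q$ for all $q\in Q$, $\sigma\in\Sigma$, and a weight function $\gamma:Q\times\Sigma\times Q\to\mathbb{Q}$. It is deterministic if $\rho_I$ and all $\delta(q,\sigma)$ are point masses. A run over $w=\sigma_1\sigma_2\cdots\in\Sigma^\omega$ is a sequence $q_0\sigma_1q_1\sigma_2\cdots$ with $\rho_I(q_0)>0$ and $\delta(q_i,\sigma_{i+1})(q_{i+1})>0$ for all $i\ge 0$; write $\gamma(r)=v_0v_1\cdots$ with $v_i=\gamma(q_i,\sigma_{i+1},q_{i+1})$ for its weights. Let $\mathbb{P}^A$ be the probability measure on the runs over $w$ with $\mathbb{P}^A(q_0\sigma_1\cdots\sigma_kq_k)=\rho_I(q_0)\prod_{i=1}^{k}\delta(q_{i-1},\sigma_i)(q_i)$. Put $\mathsf{LimAvg}(v)=\liminf_{n\to\infty}\frac1n\sum_{i=0}^{n-1}v_i$. An AsLimAvg automaton is such an automaton $A$ with the almost-sure language $$L_A^{=1}(w)=\sup\{\eta\in\mathbb{R}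 : \mathbb{P}^A(\{r : \mathsf{LimAvg}(\gamma(r))\ge\eta\})=1\}.$$ A DLimAvg automaton is a deterministic one, with language $w\mapsto\sup\{\mathsf{LimAvg}(\gamma(r)) : r \text{ a run over } w\}$. AsLimAvg is closed under sum if for every finite alphabet $\Sigma$ and all $L,L':\Sigma^\omega\to\mathbb{R}$ that are languages of AsLimAvg automata, so is the pointwise sum $L+L'$. **Lemma.** Let $\Sigma=\{a,b\}$ and, for $\sigma\in\Sigma$, let $L_\sigma(w)=\liminf_{n\to\infty}\frac1n\,|\{1\le i\le n : \sigma_i=\sigma\}|$ be the long-run average number of $\sigma$'s in $w=\sigma_1\sigma_2\cdots$. 1. $L_a$ and $L_b$ are languages of DLimAvg automata and also of AsLimAvg automata. 2. $L_a+L_b$ is not the language of any AsLimAvg automaton. 3. Consequently, AsLimAvg is not closed under sum. 4. Quantitatively: if $A$ is an AsLimAvg automaton over $\{a,b\}$ with $L^{=1}_A(u\,a^\omega)=L^{=1}_A(u\,b^\omega)=1$ for every finite word $u$ (these are the values of $L_a+L_b$ on such words), then there is a word $w\in\{a,b\}^\omega$ with $L_a(w)=L_b(w)=0$ and $L^{=1}_A(w)\ge\frac16$.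 -/

import Mathlib

open MeasureTheory ProbabilityTheory Filter Finset

/-- Infinite words over the alphabet `S`; the letter read at step `n` (from `0`) is `w n`. -/
abbrev InfWord (S : Type) : Type := ℕ → S

/-- Quantitative languages over the alphabet `S`. -/
abbrev QuantLang (S : Type) : Type := InfWord S → ℝ

/-- The limit-average value of a sequence of rational numbers. -/
noncomputable def limAvg (v : ℕ → ℚ) : ℝ :=
  liminf (fun n : ℕ => (1 / (n : ℝ)) * ∑ i ∈ range n, (v i : ℝ)) atTop

/-- Probabilistic weighted automata over the alphabet `S`: a finite set of states, an initial
distribution, a probabilistic transition function and a rational weight function. -/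
structure ProbWeightedAutomaton (S : Type) where
  /-- the set of states -/
  State : Type
  /-- the set of states is finite -/
  [finiteState : Finite State]
  /-- the initial distribution -/
  init : PMF State
  /-- the probabilistic transition function -/
  step : State → S → PMF State
  /-- the weight function -/
  weight : State → S → State → ℚ

namespace ProbWeightedAutomaton

variable {S : Type} (A : ProbWeightedAutomaton S)

instance instFiniteState : Finite A.State := A.finiteState

instance instMeasurableSpaceState : MeasurableSpace A.State := ⊤

instance instDiscreteMeasurableSpaceState : DiscreteMeasurableSpace A.State := ⟨fun _ => trivial⟩

/-- The state sequences of the runs of `A` over the infinite word `w`; the letters of a run are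
those of `w`. -/
def runs (w : InfWord S) : Set (ℕ → A.State) :=
  {r | 0 < A.init (r 0) ∧ ∀ i, 0 < A.step (r i) (w i) (r (i + 1))}

/-- The sequence of weights along a run over `w`. -/
def weights (w : InfWord S) (r : ℕ → A.State) : ℕ → ℚ :=
  fun i => A.weight (r i) (w i) (r (i + 1))

/-- Given the states up to time `n`, the law of the state at time `n + 1` when reading `w`. -/
noncomputable def stepKernel (w : InfWord S) (n : ℕ) :
    Kernel (Π _ : Iic n, A.State) A.State :=
  Kernel.ofFunOfCountable fun h => (A.step (h ⟨n, mem_Iic.2 le_rfl⟩) (w n)).toMeasure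

instance instIsMarkovKernelStepKernel (w : InfWord S) (n : ℕ) :
    IsMarkovKernel (A.stepKernel w n) :=
  ⟨fun h => by
    change IsProbabilityMeasure (A.step (h ⟨n, mem_Iic.2 le_rfl⟩) (w n)).toMeasure
    infer_instance⟩

/-- The probability measure on infinite state sequences that `A` induces on the word `w`. -/
noncomputable def runMeasure (w : InfWord S) : Measure (ℕ → A.State) :=
  Kernel.trajMeasure (X := fun _ => A.State) A.init.toMeasure (A.stepKernel w)

/-- The measure is the one determined by the probabilities of the finite runs. -/
theorem runMeasure_cylinder (w : InfWord S) (p : ℕ → A.State) (k : ℕ) :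
    A.runMeasure w {r | ∀ i ≤ k, r i = p i} =
      A.init (p 0) * ∏ i ∈ range k, A.step (p i) (w i) (p (i + 1)) := by
  have hmeas (k : ℕ) : {r : ℕ → A.State | ∀ i ≤ k, r i = p i} =
      Preorder.frestrictLe (π := fun _ => A.State) k ⁻¹' {fun i : Iic k => p i} := by
    ext r
    simp [funext_iff, Preorder.frestrictLe]
  induction k with
  | zero =>
    have hk : (A.runMeasure w).map (Preorder.frestrictLe (π := fun _ => A.State) 0) =
        A.init.toMeasure.map (MeasurableEquiv.piUnique (fun _ : Iic 0 => A.State)).symm := by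
      rw [runMeasure, Kernel.trajMeasure, Measure.map_comp _ _ (by fun_prop),
        Kernel.traj_map_frestrictLe, Kernel.partialTraj_self, Measure.id_comp]
    rw [hmeas, ← Measure.map_apply (by fun_prop) (measurableSet_singleton _), hk,
      Measure.map_apply (by fun_prop) (measurableSet_singleton _)]
    have : (MeasurableEquiv.piUnique (fun _ : Iic 0 => A.State)).symm ⁻¹' {fun i : Iic 0 => p i} =
        {p 0} := by
      ext q
      simp only [Set.mem_preimage, Set.mem_singleton_iff]
      rw [MeasurableEquiv.symm_apply_eq]
      rfl
    rw [this, PMF.toMeasure_apply_singleton _ _ (measurableSet_singleton _)]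
    simp
  | succ k ih =>
    have hset : {r : ℕ → A.State | ∀ i ≤ k + 1, r i = p i} =
        (fun x => (Preorder.frestrictLe (π := fun _ => A.State) k x, x (k + 1))) ⁻¹'
          ({fun i : Iic k => p i} ×ˢ {p (k + 1)}) := by
      ext r
      simp only [Set.mem_ofPred_eq, Set.mem_preimage, Set.mem_prod, Set.mem_singleton_iff]
      constructor
      · exact fun h => ⟨funext fun i => h i ((mem_Iic.1 i.2).trans k.le_succ), h _ le_rfl⟩
      · rintro ⟨h, h'⟩ i hi
        rcases Nat.le_succ_iff.1 hi with hi | rfl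
        · exact congrFun h ⟨i, mem_Iic.2 hi⟩
        · exact h'
    rw [hset, ← Measure.map_apply (by fun_prop)
      ((measurableSet_singleton _).prod (measurableSet_singleton _)), runMeasure,
      ← Kernel.map_frestrictLe_trajMeasure_compProd_eq_map_trajMeasure,
      Measure.compProd_apply_prod (measurableSet_singleton _) (measurableSet_singleton _),
      lintegral_singleton, Measure.map_apply (by fun_prop) (measurableSet_singleton _),
      ← hmeas, ← runMeasure, ih, prod_range_succ, mul_comm, ← mul_assoc]
    congr 1
    exact PMF.toMeasure_apply_singleton _ _ (measurableSet_singleton _)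

/-- The language of the probabilistic limit-average automaton `A` in the almost-sure semantics. -/
noncomputable def asLimAvg : QuantLang S := fun w =>
  sSup {η : ℝ | A.runMeasure w {r | r ∈ A.runs w ∧ η ≤ limAvg (A.weights w r)} = 1}

/-- The language of `A` as a non-probabilistic limit-average automaton: the maximal value of the
runs. -/
noncomputable def maxLimAvg : QuantLang S := fun w =>
  sSup {x : ℝ | ∃ r ∈ A.runs w, x = limAvg (A.weights w r)}

/-- Deterministic automata: the initial distribution and all transitions are point masses. -/
def IsDeterministic : Prop :=
  (∃ q, A.init q = 1) ∧ ∀ q σ, ∃ q', A.step q σ q' = 1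

end ProbWeightedAutomaton

/-- `L` is the language of some limit-average automaton in the almost-sure semantics. -/
def IsAsLimAvg {S : Type} (L : QuantLang S) : Prop :=
  ∃ A : ProbWeightedAutomaton S, A.asLimAvg = L

/-- `L` is the language of some deterministic limit-average automaton. -/
def IsDLimAvg {S : Type} (L : QuantLang S) : Prop :=
  ∃ A : ProbWeightedAutomaton S, A.IsDeterministic ∧ A.maxLimAvg = L

/-- A class of quantitative languages over finite alphabets is closed under sum. -/
def ClosedUnderSum (C : ∀ S : Type, QuantLang S → Prop) : Prop :=
  ∀ (S : Type) [Finite S] (L L' : QuantLang S), C S L → C S L' → C S (L + L')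

/-- The alphabet `{a, b}`. -/
inductive Letter : Type where
  | a : Letter
  | b : Letter
  deriving DecidableEq

instance instFiniteLetter : Finite Letter :=
  Finite.of_injective (fun σ => decide (σ = Letter.a)) fun σ τ h => by
    cases σ <;> cases τ <;> simp_all

/-- The language that assigns to a word over `{a, b}` the long-run average number of occurrences
of the letter `σ`. -/
noncomputable def freqLang (σ : Letter) : QuantLang Letter := fun w =>
  limAvg fun i => if w i = σ then 1 else 0

/-- The infinite word `u σ σ σ …`. -/
def appendConst {S : Type} (u : List S) (σ : S) : InfWord S := fun n => u.getD n σ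

/-! Each frequency language is given by a one-state automaton counting its letter, so everything
rests on the quantitative claim. Let `A` have value 1 on all words `u a^ω` and `u b^ω`. If a state
`q` is reachable, say by `u`, then almost every continuation from `q` reading only `σ` has limit
average at least 1, so its partial sums fall below `n / 2` by a finite amount only. Hence for every
`δ` some `K` bounds this shortfall, at all times at once, with conditional probability at least `1 -
δ`. By the Markov property `K` depends only on `q`, `σ` and `δ`; as there are finitely many states
and letters, it depends only on `δ` (`exists_measure_deviationSet_le`).

Now let `w` alternate blocks of `a` and of `b`, with `K k` belonging to `δ = 2⁻ᵏ`. Since `K k` does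
not depend on the word or on block lengths, the block ends `t k` can be chosen after it, growing so
fast that each block dwarfs its past and the next constant. Both frequencies are then 0. By
Borel–Cantelli almost every run has shortfall at most `K k` in all but finitely many blocks, which
forces limit average at least 1/6. The sum `L_a + L_b` is 0 at `w`, so `A` does not define it. -/

/-- The sequences that agree with `p` up to time `m`. -/
def pathCylinder {Q : Type} (m : ℕ) (p : ℕ → Q) : Set (ℕ → Q) := {r | ∀ i ≤ m, r i = p i}

/-- Membership in `E` depends only on the coordinates up to time `m`. -/
def DependsUpTo {Q : Type} (m : ℕ) (E : Set (ℕ → Q)) : Prop :=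
  ∀ r p : ℕ → Q, (∀ i ≤ m, r i = p i) → (r ∈ E ↔ p ∈ E)

theorem dependsUpTo_state_eq {Q : Type} (N : ℕ) (q : Q) :
    DependsUpTo N {r : ℕ → Q | r N = q} := fun r p h => by simp [h N le_rfl]

/-- The sequence `r` from time `N` on. -/
def seqShift {Q : Type} (N : ℕ) (r : ℕ → Q) : ℕ → Q := fun i => r (N + i)

/-! ### Events determined by finitely many coordinates -/

section Cylinders

variable {Q : Type} [MeasurableSpace Q]

theorem measurable_seqShift (N : ℕ) : Measurable (seqShift (Q := Q) N) :=
  measurable_pi_lambda _ fun i => measurable_pi_apply (N + i)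

variable [DiscreteMeasurableSpace Q]

theorem measurableSet_pathCylinder (m : ℕ) (p : ℕ → Q) : MeasurableSet (pathCylinder m p) := by
  have : pathCylinder m p = ⋂ i, ⋂ (_ : i ≤ m), (fun r : ℕ → Q => r i) ⁻¹' {p i} := by
    ext r; simp [pathCylinder]
  rw [this]
  exact MeasurableSet.iInter fun i => MeasurableSet.iInter fun _ =>
    measurable_pi_apply i (MeasurableSet.of_discrete)

/-- Splitting into cylinders reduces facts about run measures to the product formula. `T` does not
depend on `μ`, so two words can be compared term by term. -/
theorem DependsUpTo.exists_finset [Finite Q] {m : ℕ} {E : Set (ℕ → Q)}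
    (hE : DependsUpTo m E) :
    ∃ T : Finset (ℕ → Q), (∀ p ∈ T, p ∈ E) ∧
      ∀ μ : Measure (ℕ → Q), μ E = ∑ p ∈ T, μ (pathCylinder m p) := by
  classical
  have := Fintype.ofFinite Q
  let e : (Fin (m + 1) → Q) → ℕ → Q := fun x i => x ⟨min i m, by omega⟩
  refine ⟨(univ.filter fun x => e x ∈ E).image e, by simp, fun μ => ?_⟩
  rw [← measure_biUnion_finset]
  · congr 1
    ext r
    simp only [Set.mem_iUnion, Finset.mem_image, Finset.mem_filter, Finset.mem_univ, true_and,
      exists_prop]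
    constructor
    · intro hr
      have hx : ∀ i ≤ m, r i = e (fun j => r j) i := fun i hi => by simp [e, hi]
      exact ⟨_, ⟨fun j => r j, (hE _ _ hx).1 hr, rfl⟩, hx⟩
    · rintro ⟨p, ⟨x, hx, rfl⟩, hr⟩
      exact (hE _ _ hr).2 hx
  · intro p hp p' hp' hne
    obtain ⟨x, -, rfl⟩ := Finset.mem_image.1 hp
    obtain ⟨x', -, rfl⟩ := Finset.mem_image.1 hp'
    refine Set.disjoint_left.2 fun r hr hr' => hne ?_
    congr 1
    ext i
    have h1 := (hr i (by omega)).symm.trans (hr' i (by omega))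
    have hi : min (i : ℕ) m = i := by omega
    simpa [e, hi] using h1
  · exact fun p _ => measurableSet_pathCylinder m p

theorem DependsUpTo.measurableSet [Finite Q] {m : ℕ} {E : Set (ℕ → Q)}
    (hE : DependsUpTo m E) : MeasurableSet E := by
  have : E = ⋃ x ∈ Set.range (fun p : ℕ → Q => fun i : Fin (m + 1) => p i) ∩
      {x | ∃ p ∈ E, ∀ i : Fin (m + 1), p i = x i}, ⋂ i : Fin (m + 1),
        (fun r : ℕ → Q => r i) ⁻¹' {x i} := by
    ext r
    simp only [Set.mem_iUnion, Set.mem_iInter, Set.mem_preimage, Set.mem_singleton_iff]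
    constructor
    · exact fun hr => ⟨fun i => r i, ⟨⟨r, rfl⟩, r, hr, fun _ => rfl⟩, fun _ => rfl⟩
    · rintro ⟨x, ⟨-, p, hp, hpx⟩, hr⟩
      refine (hE r p fun i hi => ?_).2 hp
      exact (hr ⟨i, by omega⟩).trans (hpx ⟨i, by omega⟩).symm
  rw [this]
  exact MeasurableSet.biUnion (Set.to_countable _) fun x _ => MeasurableSet.iInter fun i =>
    measurable_pi_apply _ MeasurableSet.of_discrete

end Cylinders

/-! ### The Markov property of the run measure -/

namespace ProbWeightedAutomaton

variable {S : Type} (A : ProbWeightedAutomaton S)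

instance instIsProbabilityMeasureRunMeasure (w : InfWord S) :
    IsProbabilityMeasure (A.runMeasure w) := by
  unfold runMeasure; infer_instance

/-- The law of the first states depends only on the first letters. -/
theorem runMeasure_congr {w w' : InfWord S} {m : ℕ} (hw : ∀ i < m, w i = w' i)
    {E : Set (ℕ → A.State)} (hE : DependsUpTo m E) : A.runMeasure w E = A.runMeasure w' E := by
  obtain ⟨T, -, hT⟩ := hE.exists_finset
  rw [hT, hT]
  refine sum_congr rfl fun p _ => ?_
  rw [pathCylinder, runMeasure_cylinder, runMeasure_cylinder]
  congr 1
  exact prod_congr rfl fun i hi => by rw [hw i (mem_range.1 hi)]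

theorem runMeasure_runs (w : InfWord S) : ∀ᵐ r ∂A.runMeasure w, r ∈ A.runs w := by
  have hnull (m : ℕ) (E : Set (ℕ → A.State)) (hE : DependsUpTo m E)
      (h : ∀ p ∈ E, A.init (p 0) * ∏ i ∈ range m, A.step (p i) (w i) (p (i + 1)) = 0) :
      A.runMeasure w E = 0 := by
    obtain ⟨T, hTE, hT⟩ := hE.exists_finset
    rw [hT]
    refine sum_eq_zero fun p hp => ?_
    rw [pathCylinder, runMeasure_cylinder, h p (hTE p hp)]
  have h0 : ∀ᵐ r ∂A.runMeasure w, A.init (r 0) ≠ 0 := by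
    refine (measure_eq_zero_iff_ae_notMem (s := {r : ℕ → A.State | A.init (r 0) = 0})).1 ?_
    refine hnull 0 _ (fun r p h => by simp [h 0 le_rfl]) fun p hp => ?_
    simp only [Set.mem_ofPred_eq] at hp
    simp [hp]
  have h1 : ∀ᵐ r ∂A.runMeasure w, ∀ i, A.step (r i) (w i) (r (i + 1)) ≠ 0 := by
    refine ae_all_iff.2 fun i => ?_
    refine (measure_eq_zero_iff_ae_notMem
      (s := {r : ℕ → A.State | A.step (r i) (w i) (r (i + 1)) = 0})).1 ?_
    refine hnull (i + 1) _ (fun r p h => by simp [h i (by omega), h (i + 1) le_rfl])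
      fun p hp => ?_
    simp only [Set.mem_ofPred_eq] at hp
    simp [prod_range_succ, hp]
  filter_upwards [h0, h1] with r hr0 hr1
  exact ⟨pos_iff_ne_zero.2 hr0, fun i => pos_iff_ne_zero.2 (hr1 i)⟩

/-- The Markov property on cylinders. -/
theorem runMeasure_shift_cylinder (w : InfWord S) (N m : ℕ) (p : ℕ → A.State) :
    A.runMeasure w ({r | r N = p 0} ∩ seqShift N ⁻¹' pathCylinder m p) =
      A.runMeasure w {r | r N = p 0} *
        ∏ i ∈ range m, A.step (p i) (w (N + i)) (p (i + 1)) := by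
  obtain ⟨T, hTE, hT⟩ := (dependsUpTo_state_eq N (p 0)).exists_finset
  have hD := measurable_seqShift N (measurableSet_pathCylinder m p)
  rw [← Measure.restrict_apply' hD, hT, hT, sum_mul]
  refine sum_congr rfl fun x hx => ?_
  have hx : x N = p 0 := hTE x hx
  -- The prefix `x` and the future `p` glue at time `N`, where both are in state `p 0`; the product
  -- formula for `y` then factors.
  let y : ℕ → A.State := fun i => if i ≤ N then x i else p (i - N)
  have hy1 (i : ℕ) (hi : i ≤ N) : y i = x i := if_pos hi
  have hy2 (i : ℕ) : y (N + i) = p i := by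
    rcases Nat.eq_zero_or_pos i with rfl | hi
    · simp [y, hx]
    · have : ¬ N + i ≤ N := by omega
      simp [y, hi.ne']
  have hset : pathCylinder N x ∩ seqShift N ⁻¹' pathCylinder m p =
      {r | ∀ i ≤ N + m, r i = y i} := by
    ext r
    constructor
    · rintro ⟨h1, h2⟩ i hi
      rcases le_total i N with h | h
      · rw [h1 i h, hy1 i h]
      · obtain ⟨j, rfl⟩ := Nat.exists_eq_add_of_le h
        rw [hy2]
        exact h2 j (by omega)
    · intro h
      refine ⟨fun i hi => by rw [h i (by omega), hy1 i hi], fun i hi => ?_⟩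
      rw [← hy2]
      exact h (N + i) (by omega)
  rw [Measure.restrict_apply' hD, hset, runMeasure_cylinder, pathCylinder, runMeasure_cylinder,
    prod_range_add, hy1 0 (Nat.zero_le _), mul_assoc]
  congr 2
  · refine prod_congr rfl fun i hi => ?_
    have := mem_range.1 hi
    rw [hy1 i this.le, hy1 (i + 1) this]
  · refine prod_congr rfl fun i _ => ?_
    rw [add_assoc, hy2, hy2]

/-- The future after time `N`, given the state at that time, has a law that depends only on the
letters read. -/
theorem runMeasure_shift_mul_comm {w w' : InfWord S} {N N' m : ℕ} (q : A.State)
    (hw : ∀ i < m, w (N + i) = w' (N' + i)) {E : Set (ℕ → A.State)} (hE : DependsUpTo m E) :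
    A.runMeasure w ({r | r N = q} ∩ seqShift N ⁻¹' E) * A.runMeasure w' {r | r N' = q} =
      A.runMeasure w' ({r | r N' = q} ∩ seqShift N' ⁻¹' E) * A.runMeasure w {r | r N = q} := by
  obtain ⟨T, -, hT⟩ := hE.exists_finset
  have hsum (v : InfWord S) (M : ℕ) : A.runMeasure v ({r | r M = q} ∩ seqShift M ⁻¹' E) =
      ∑ p ∈ T, A.runMeasure v ({r | r M = q} ∩ seqShift M ⁻¹' pathCylinder m p) := by
    have hM := (dependsUpTo_state_eq (Q := A.State) M q).measurableSet
    have h (F : Set (ℕ → A.State)) (hF : MeasurableSet F) :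
        (((A.runMeasure v).restrict {r | r M = q}).map (seqShift M)) F =
          A.runMeasure v ({r | r M = q} ∩ seqShift M ⁻¹' F) := by
      rw [Measure.map_apply (measurable_seqShift M) hF, Measure.restrict_apply' hM,
        Set.inter_comm]
    rw [← h E hE.measurableSet, hT]
    exact sum_congr rfl fun p _ => h _ (measurableSet_pathCylinder m p)
  rw [hsum, hsum, sum_mul, sum_mul]
  refine sum_congr rfl fun p _ => ?_
  by_cases hp : p 0 = q
  · subst hp
    rw [runMeasure_shift_cylinder, runMeasure_shift_cylinder,
      prod_congr rfl fun i hi => by rw [hw i (mem_range.1 hi)]]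
    ring
  · have h (v : InfWord S) (M : ℕ) :
        {r : ℕ → A.State | r M = q} ∩ seqShift M ⁻¹' pathCylinder m p = ∅ := by
      ext r
      simp only [Set.mem_inter_iff, Set.mem_ofPred_eq, Set.mem_preimage, Set.mem_empty_iff_false,
        iff_false, not_and]
      intro h1 h2
      have := h2 0 (Nat.zero_le _)
      exact hp (this.symm.trans h1)
    rw [h w N, h w' N']
    simp

end ProbWeightedAutomaton

/-! ### Limit averages of bounded sequences -/

section LimAvg

variable {v : ℕ → ℚ} {β : ℝ}

theorem abs_average_le (hv : ∀ i, |(v i : ℝ)| ≤ β) (hβ : 0 ≤ β) (n : ℕ) :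
    |(1 / (n : ℝ)) * ∑ i ∈ range n, (v i : ℝ)| ≤ β := by
  rcases Nat.eq_zero_or_pos n with rfl | hn
  · simpa using hβ
  · have hn' : (0 : ℝ) < n := by exact_mod_cast hn
    have : |∑ i ∈ range n, (v i : ℝ)| ≤ n * β := by
      refine (abs_sum_le_sum_abs _ _).trans ((sum_le_sum fun i _ => hv i).trans ?_)
      simp
    rw [abs_mul, abs_of_pos (by positivity), one_div, inv_mul_le_iff₀ hn']
    exact this

theorem isBoundedUnder_ge_average (hv : ∀ i, |(v i : ℝ)| ≤ β) (hβ : 0 ≤ β) :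
    IsBoundedUnder (· ≥ ·) atTop fun n : ℕ => (1 / (n : ℝ)) * ∑ i ∈ range n, (v i : ℝ) :=
  isBoundedUnder_of ⟨-β, fun n => (abs_le.1 (abs_average_le hv hβ n)).1⟩

theorem isCoboundedUnder_ge_average (hv : ∀ i, |(v i : ℝ)| ≤ β) (hβ : 0 ≤ β) :
    IsCoboundedUnder (· ≥ ·) atTop fun n : ℕ => (1 / (n : ℝ)) * ∑ i ∈ range n, (v i : ℝ) :=
  (isBoundedUnder_of ⟨β, fun n => (abs_le.1 (abs_average_le hv hβ n)).2⟩ :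
    IsBoundedUnder (· ≤ ·) atTop _).isCoboundedUnder_ge

theorem limAvg_le (hv : ∀ i, |(v i : ℝ)| ≤ β) (hβ : 0 ≤ β) : limAvg v ≤ β :=
  liminf_le_of_frequently_le
    (Frequently.of_forall fun n => (abs_le.1 (abs_average_le hv hβ n)).2)
    (isBoundedUnder_ge_average hv hβ)

theorem le_limAvg (hv : ∀ i, |(v i : ℝ)| ≤ β) (hβ : 0 ≤ β) {c : ℝ}
    (h : ∀ᶠ n : ℕ in atTop, c * n ≤ ∑ i ∈ range n, (v i : ℝ)) : c ≤ limAvg v := by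
  refine le_liminf_of_le (isCoboundedUnder_ge_average hv hβ) ?_
  filter_upwards [h, eventually_gt_atTop 0] with n hn hn0
  have hn' : (0 : ℝ) < n := by exact_mod_cast hn0
  rw [one_div, le_inv_mul_iff₀ hn', mul_comm]
  exact hn

theorem eventually_lt_sum_of_lt_limAvg (hv : ∀ i, |(v i : ℝ)| ≤ β) (hβ : 0 ≤ β) {c : ℝ}
    (h : c < limAvg v) : ∀ᶠ n : ℕ in atTop, c * n < ∑ i ∈ range n, (v i : ℝ) := by
  filter_upwards [eventually_lt_of_lt_liminf h (isBoundedUnder_ge_average hv hβ),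
    eventually_gt_atTop 0] with n hn hn0
  have hn' : (0 : ℝ) < n := by exact_mod_cast hn0
  rwa [one_div, lt_inv_mul_iff₀ hn', mul_comm] at hn

theorem limAvg_eq_of_eventually_eq {c : ℚ} (h : ∀ᶠ i in atTop, v i = c) :
    limAvg v = c := by
  have h1 : Tendsto (fun i => (v i : ℝ)) atTop (nhds (c : ℝ)) :=
    tendsto_const_nhds.congr' (h.mono fun i hi => by simp [hi])
  have h2 := h1.cesaro
  simp only [← one_div] at h2
  exact h2.liminf_eq

/-- A late block outweighs all earlier losses, so the average at its end is at least 1/3. Inside the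
next block, started at `t k` with `6 K k ≤ t k`, the sum up to `n` is at least `t k / 3 + (n - t k)
/ 2 - t k / 6 ≥ n / 6`, because `t k ≤ n`. -/
theorem one_sixth_le_limAvg_of_blocks (hv : ∀ i, |(v i : ℝ)| ≤ β) (hβ : 0 ≤ β) {t K : ℕ → ℕ}
    (ht : ∀ k, t (k + 1) = (k + 2) * (t k + K (k + 1) + 1))
    (h : ∀ᶠ k in atTop, ∀ n ≤ t (k + 1) - t k,
      (n : ℝ) / 2 ≤ ∑ i ∈ range n, (v (t k + i) : ℝ) + K k) : 1 / 6 ≤ limAvg v := by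
  have hlt (k : ℕ) : t k < t (k + 1) := by rw [ht]; nlinarith [Nat.zero_le (k * t k)]
  have hmono : StrictMono t := strictMono_nat_of_lt_succ hlt
  have hlow (n : ℕ) : -(β * n) ≤ ∑ i ∈ range n, (v i : ℝ) := by
    have : |∑ i ∈ range n, (v i : ℝ)| ≤ n * β := by
      refine (abs_sum_le_sum_abs _ _).trans ((sum_le_sum fun i _ => hv i).trans ?_)
      simp
    linarith [(abs_le.1 this).1]
  obtain ⟨k₀, hk₀⟩ := eventually_atTop.1 h
  -- The past costs at most `β t k`, the shortfall at most `K k ≤ t k`, and the missing `t k / 2` is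
  -- lost too; all this fits into `t (k + 1) / 6` once `t (k + 1) ≥ (6 β + 9) t k`.
  obtain ⟨k₁, hk₁⟩ := exists_nat_ge (6 * β + 12)
  have key (k : ℕ) (hk : k₀ + k₁ + 6 ≤ k) : (t (k + 1) : ℝ) / 3 ≤
      ∑ i ∈ range (t (k + 1)), (v i : ℝ) := by
    have hb := hk₀ k (by omega) _ le_rfl
    have hs : ∑ i ∈ range (t (k + 1)), (v i : ℝ) =
        ∑ i ∈ range (t k), (v i : ℝ) + ∑ i ∈ range (t (k + 1) - t k), (v (t k + i) : ℝ) := by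
      rw [← sum_range_add, Nat.add_sub_cancel' (hlt k).le]
    rw [Nat.cast_sub (hlt k).le] at hb
    obtain ⟨j, rfl⟩ : ∃ j, k = j + 1 := ⟨k - 1, by omega⟩
    have e1 : (K (j + 1) : ℝ) ≤ t (j + 1) := by
      rw [ht]; push_cast; nlinarith [(Nat.cast_nonneg (t j) : (0:ℝ) ≤ _),
        (Nat.cast_nonneg (K (j+1)) : (0:ℝ) ≤ _), (Nat.cast_nonneg j : (0:ℝ) ≤ _),
        mul_nonneg (Nat.cast_nonneg j : (0:ℝ) ≤ _) (Nat.cast_nonneg (t j) : (0:ℝ) ≤ _),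
        mul_nonneg (Nat.cast_nonneg j : (0:ℝ) ≤ _) (Nat.cast_nonneg (K (j+1)) : (0:ℝ) ≤ _)]
    have e2 : (6 * β + 12) * (t (j + 1) : ℝ) ≤ t (j + 1 + 1) := by
      have hk' : 6 * β + 12 ≤ ((j + 1 + 2 : ℕ) : ℝ) :=
        hk₁.trans (by exact_mod_cast (by omega : k₁ ≤ j + 1 + 2))
      rw [ht (j + 1)]
      push_cast at hk' ⊢
      have : (0 : ℝ) ≤ (j + 1 + 2) * (K (j + 1 + 1) + 1) := by positivity
      have := mul_le_mul_of_nonneg_right hk' (Nat.cast_nonneg (t (j + 1)) : (0:ℝ) ≤ _)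
      linarith
    have e3 := hlow (t (j + 1))
    rw [hs]
    linarith
  refine le_limAvg hv hβ ?_
  filter_upwards [eventually_ge_atTop (t (k₀ + k₁ + 8))] with n hn
  obtain ⟨k, hk, hkn, hnk⟩ : ∃ k, k₀ + k₁ + 8 ≤ k ∧ t k ≤ n ∧ n < t (k + 1) := by
    have hex : ∃ k, n < t k := ⟨n + 1, hmono.le_apply.trans_lt' n.lt_succ_self⟩
    have h1 := Nat.find_spec hex
    have h2 : k₀ + k₁ + 8 < Nat.find hex := hmono.lt_iff_lt.1 (hn.trans_lt h1)
    refine ⟨Nat.find hex - 1, by omega, not_lt.1 (Nat.find_min hex (by omega)), ?_⟩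
    rwa [Nat.sub_add_cancel (by omega)]
  obtain ⟨j, rfl⟩ : ∃ j, k = j + 1 := ⟨k - 1, by omega⟩
  have hb := hk₀ (j + 1) (by omega) (n - t (j + 1)) (by omega)
  have hs : ∑ i ∈ range n, (v i : ℝ) =
      ∑ i ∈ range (t (j + 1)), (v i : ℝ) + ∑ i ∈ range (n - t (j + 1)), (v (t (j + 1) + i) : ℝ) := by
    rw [← sum_range_add, Nat.add_sub_cancel' hkn]
  have e0 := key j (by omega)
  have e1 : 6 * (K (j + 1) : ℝ) ≤ t (j + 1) := by
    have hj : (6 : ℝ) ≤ ((j + 2 : ℕ) : ℝ) := by exact_mod_cast (by omega : 6 ≤ j + 2)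
    rw [ht]
    push_cast at hj ⊢
    have := mul_le_mul_of_nonneg_right hj (Nat.cast_nonneg (K (j + 1)) : (0:ℝ) ≤ _)
    have : (0 : ℝ) ≤ (j + 2) * (t j + 1) := by positivity
    linarith
  have hkn' : (t (j + 1) : ℝ) ≤ n := by exact_mod_cast hkn
  rw [Nat.cast_sub hkn] at hb
  rw [hs]
  linarith

end LimAvg

/-! ### The frequency languages and their automata -/

section FreqLang

theorem abs_indicator_le_one (w : InfWord Letter) (σ : Letter) (i : ℕ) :
    |(((if w i = σ then 1 else 0 : ℚ)) : ℝ)| ≤ 1 := by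
  split_ifs <;> simp

theorem freqLang_nonneg (σ : Letter) (w : InfWord Letter) : 0 ≤ freqLang σ w := by
  refine le_limAvg (abs_indicator_le_one w σ) zero_le_one (Eventually.of_forall fun n => ?_)
  rw [zero_mul]
  exact sum_nonneg fun i _ => by split_ifs <;> simp

/-- At the end of a `σ`-free block at most `t k` of the `t (k + 1)` letters are `σ`, a proportion of
at most `1 / (k + 2)`. -/
theorem freqLang_eq_zero_of_blocks {σ : Letter} {w : InfWord Letter} {t : ℕ → ℕ}
    (ht : ∀ k, (k + 2) * (t k + 1) ≤ t (k + 1))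
    (hw : ∃ᶠ k in atTop, ∀ n, t k ≤ n → n < t (k + 1) → w n ≠ σ) : freqLang σ w = 0 := by
  refine le_antisymm (le_of_forall_pos_lt_add fun ε hε => ?_) (freqLang_nonneg σ w)
  by_contra hcon
  have hcon : ε / 2 < freqLang σ w := by linarith
  obtain ⟨n₀, hn₀⟩ := eventually_atTop.1
    (eventually_lt_sum_of_lt_limAvg (abs_indicator_le_one w σ) zero_le_one hcon)
  obtain ⟨k₀, hk₀⟩ := exists_nat_gt (2 / ε)
  obtain ⟨k, hk, hkw⟩ := frequently_atTop.1 hw (n₀ + k₀)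
  have hlt (k : ℕ) : t k < t (k + 1) := by nlinarith [ht k, Nat.zero_le (k * t k)]
  have hmono : StrictMono t := strictMono_nat_of_lt_succ hlt
  have h1 := hn₀ (t (k + 1)) (by have := hmono.le_apply (x := k + 1); omega)
  rw [← Nat.add_sub_cancel' (hlt k).le, sum_range_add] at h1
  have h2 : ∑ i ∈ range (t (k + 1) - t k), (((if w (t k + i) = σ then 1 else 0 : ℚ)) : ℝ) = 0 :=
    sum_eq_zero fun i hi => by
      have := mem_range.1 hi
      rw [if_neg (hkw _ (by omega) (by omega))]; simp
  have h3 : ∑ i ∈ range (t k), (((if w i = σ then 1 else 0 : ℚ)) : ℝ) ≤ t k := by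
    refine (sum_le_sum fun i _ => (abs_le.1 (abs_indicator_le_one w σ i)).2).trans ?_
    simp
  rw [h2, add_zero, Nat.add_sub_cancel' (hlt k).le] at h1
  have h4 : ((k : ℝ) + 2) * (t k + 1) ≤ t (k + 1) := by exact_mod_cast ht k
  have h5 : 2 / ε < k := hk₀.trans_le (by exact_mod_cast (by omega : k₀ ≤ k))
  rw [div_lt_iff₀ hε] at h5
  have h6 : (0 : ℝ) ≤ t k := Nat.cast_nonneg _
  nlinarith [mul_le_mul_of_nonneg_left h4 hε.le]

theorem freqLang_appendConst (u : List Letter) (σ τ : Letter) :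
    freqLang τ (appendConst u σ) = if σ = τ then 1 else 0 := by
  have := limAvg_eq_of_eventually_eq (v := fun i => if appendConst u σ i = τ then 1 else 0)
    (c := if σ = τ then 1 else 0) (by
      filter_upwards [eventually_ge_atTop u.length] with i hi
      simp [appendConst, hi])
  rw [freqLang, this]
  split_ifs <;> simp

theorem freqLang_add_appendConst (u : List Letter) (σ : Letter) :
    (freqLang Letter.a + freqLang Letter.b) (appendConst u σ) = 1 := by
  cases σ <;> simp [freqLang_appendConst]

/-- The one-state automaton whose weights count the letter `σ`. -/
noncomputable def freqAutomaton (σ : Letter) : ProbWeightedAutomaton Letter where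
  State := Unit
  init := PMF.pure ()
  step _ _ := PMF.pure ()
  weight _ τ _ := if τ = σ then 1 else 0

theorem freqAutomaton_runs (σ : Letter) (w : InfWord Letter) :
    (freqAutomaton σ).runs w = Set.univ := by
  refine Set.eq_univ_of_forall fun r => ⟨?_, fun i => ?_⟩
  · change 0 < PMF.pure () ()
    simp
  · change 0 < PMF.pure () ()
    simp

theorem freqAutomaton_limAvg (σ : Letter) (w : InfWord Letter)
    (r : ℕ → (freqAutomaton σ).State) :
    limAvg ((freqAutomaton σ).weights w r) = freqLang σ w := rfl

theorem isDLimAvg_freqLang (σ : Letter) : IsDLimAvg (freqLang σ) := by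
  refine ⟨freqAutomaton σ, ⟨⟨(), PMF.pure_apply_self _⟩, fun _ _ => ⟨(), PMF.pure_apply_self _⟩⟩,
    funext fun w => ?_⟩
  have : {x : ℝ | ∃ r ∈ (freqAutomaton σ).runs w, x = limAvg ((freqAutomaton σ).weights w r)} =
      {freqLang σ w} := by
    ext x
    simp only [freqAutomaton_runs, freqAutomaton_limAvg, Set.mem_univ, true_and,
      Set.mem_ofPred_eq, Set.mem_singleton_iff]
    exact ⟨fun ⟨_, h⟩ => h, fun h => ⟨fun _ => (), h⟩⟩
  rw [ProbWeightedAutomaton.maxLimAvg, this, csSup_singleton]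

theorem isAsLimAvg_freqLang (σ : Letter) : IsAsLimAvg (freqLang σ) := by
  refine ⟨freqAutomaton σ, funext fun w => ?_⟩
  have : {η : ℝ | (freqAutomaton σ).runMeasure w {r | r ∈ (freqAutomaton σ).runs w ∧
      η ≤ limAvg ((freqAutomaton σ).weights w r)} = 1} = Set.Iic (freqLang σ w) := by
    ext η
    simp only [freqAutomaton_runs, freqAutomaton_limAvg, Set.mem_univ, true_and,
      Set.mem_ofPred_eq, Set.mem_Iic]
    by_cases h : η ≤ freqLang σ w
    · simp [h, Set.ofPred_true]
    · simp [h, Set.ofPred_false]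
  rw [ProbWeightedAutomaton.asLimAvg, this, csSup_Iic]

end FreqLang

open scoped ENNReal

/-! ### Uniform bounds on the shortfall -/

namespace ProbWeightedAutomaton

section Deviation

variable {S : Type} (A : ProbWeightedAutomaton S)

theorem exists_abs_weight_le [Finite S] :
    ∃ β : ℝ, 0 ≤ β ∧ ∀ q σ q', |(A.weight q σ q' : ℝ)| ≤ β := by
  obtain ⟨β, hβ⟩ := (Set.finite_range
    fun x : A.State × S × A.State => |(A.weight x.1 x.2.1 x.2.2 : ℝ)|).bddAbove
  exact ⟨max β 0, le_max_right _ _, fun q σ q' =>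
    (hβ ⟨(q, σ, q'), rfl⟩).trans (le_max_left _ _)⟩

theorem le_asLimAvg [Finite S] {w : InfWord S} {c : ℝ}
    (h : ∀ᵐ r ∂A.runMeasure w, c ≤ limAvg (A.weights w r)) : c ≤ A.asLimAvg w := by
  obtain ⟨β, hβ, hw⟩ := A.exists_abs_weight_le
  refine le_csSup ⟨β, fun η hη => ?_⟩ ?_
  · have hne : A.runMeasure w {r | r ∈ A.runs w ∧ η ≤ limAvg (A.weights w r)} ≠ 0 := by
      rw [Set.mem_ofPred_eq] at hη
      rw [hη]
      exact one_ne_zero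
    obtain ⟨r, -, hr⟩ := nonempty_of_measure_ne_zero hne
    exact hr.trans (limAvg_le (fun i => hw _ _ _) hβ)
  · refine (measure_eq_measure_of_null_sdiff (Set.subset_univ _) ?_).trans measure_univ
    rw [← Set.compl_eq_univ_sdiff]
    exact (A.runMeasure_runs w).and h

theorem measurable_limAvg_weights (w : InfWord S) :
    Measurable fun r => limAvg (A.weights w r) := by
  refine Measurable.liminf fun n => measurable_const.mul (Finset.measurable_sum _ fun i _ => ?_)
  have hpair : Measurable fun r : ℕ → A.State => (r i, r (i + 1)) :=
    (measurable_pi_apply i).prodMk (measurable_pi_apply (i + 1))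
  have hweight : Measurable fun x : A.State × A.State => (A.weight x.1 (w i) x.2 : ℝ) :=
    Measurable.of_discrete
  exact hweight.comp hpair

theorem ae_lt_limAvg_of_lt_asLimAvg {w : InfWord S} {c : ℝ} (h : c < A.asLimAvg w)
    (hne : A.asLimAvg w ≠ 0) : ∀ᵐ r ∂A.runMeasure w, c < limAvg (A.weights w r) := by
  have hn : {η : ℝ | A.runMeasure w
      {r | r ∈ A.runs w ∧ η ≤ limAvg (A.weights w r)} = 1}.Nonempty := by
    -- An empty set would have `sSup` equal to the default value 0, which `hne` excludes.
    by_contra hn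
    rw [Set.not_nonempty_iff_eq_empty] at hn
    exact hne (by rw [asLimAvg, hn, Real.sSup_empty])
  obtain ⟨η, hη, hc⟩ := exists_lt_of_lt_csSup hn h
  rw [Set.mem_ofPred_eq] at hη
  have hbig : A.runMeasure w {r | c < limAvg (A.weights w r)} = 1 :=
    le_antisymm prob_le_one (hη ▸ measure_mono fun r hr => hc.trans_le hr.2)
  exact (prob_compl_eq_zero_iff (measurableSet_lt measurable_const (A.measurable_limAvg_weights w))).2
    hbig

/-- The paths that, reading `σ` only, fall short of the average `1 / 2` by more than `K` at some
time up to `m`. -/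
def deviationSet (σ : S) (K m : ℕ) : Set (ℕ → A.State) :=
  {r | ∃ n ≤ m, ∑ i ∈ range n, (A.weight (r i) σ (r (i + 1)) : ℝ) + K < (n : ℝ) / 2}

theorem dependsUpTo_deviationSet (σ : S) (K m : ℕ) :
    DependsUpTo m (A.deviationSet σ K m) := by
  intro r p h
  refine exists_congr fun n => and_congr_right fun hn => ?_
  rw [sum_congr rfl fun i hi => ?_]
  have := mem_range.1 hi
  rw [h i (by omega), h (i + 1) (by omega)]

theorem deviationSet_anti (σ : S) {K K' : ℕ} (m : ℕ) (h : K ≤ K') :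
    A.deviationSet σ K' m ⊆ A.deviationSet σ K m := by
  rintro r ⟨n, hn, hr⟩
  refine ⟨n, hn, ?_⟩
  have : (K : ℝ) ≤ K' := by exact_mod_cast h
  linarith

theorem ae_exists_notMem_deviationSet [Finite S] {w : InfWord S} {σ : S} {N : ℕ}
    (hw : ∀ i, w (N + i) = σ) (h : A.asLimAvg w = 1) :
    ∀ᵐ r ∂A.runMeasure w, ∃ K, ∀ m, seqShift N r ∉ A.deviationSet σ K m := by
  obtain ⟨β, hβ, hwt⟩ := A.exists_abs_weight_le
  have h34 : (3 / 4 : ℝ) < A.asLimAvg w := by rw [h]; norm_num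
  filter_upwards [A.ae_lt_limAvg_of_lt_asLimAvg h34 (by rw [h]; norm_num)] with r hr
  have habs (i : ℕ) : |(A.weights w r i : ℝ)| ≤ β := hwt _ _ _
  obtain ⟨n₀, hn₀⟩ := eventually_atTop.1 (eventually_lt_sum_of_lt_limAvg habs hβ hr)
  -- `β * N` pays for the weights before time `N`, and `β * n₀ + n₀` for times before the averages
  -- stay above 3/4.
  obtain ⟨K, hK⟩ := exists_nat_ge (β * (N + n₀) + n₀)
  refine ⟨K, fun m => ?_⟩
  rintro ⟨n, -, hn⟩
  have hsum : ∑ i ∈ range n, (A.weight (seqShift N r i) σ (seqShift N r (i + 1)) : ℝ) =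
      ∑ i ∈ range n, (A.weights w r (N + i) : ℝ) :=
    sum_congr rfl fun i _ => by simp [weights, seqShift, hw, add_assoc]
  have hbound (f : ℕ → ℕ) (n : ℕ) : |∑ i ∈ range n, (A.weights w r (f i) : ℝ)| ≤ n * β := by
    refine (abs_sum_le_sum_abs _ _).trans ((sum_le_sum fun i _ => habs _).trans ?_)
    simp
  rw [hsum] at hn
  have h0 : (0 : ℝ) ≤ N := Nat.cast_nonneg _
  have h0' : (0 : ℝ) ≤ n := Nat.cast_nonneg _
  have h0'' : (0 : ℝ) ≤ n₀ := Nat.cast_nonneg _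
  rcases le_total n₀ (N + n) with hle | hle
  · have h1 := hn₀ _ hle
    rw [sum_range_add] at h1
    have h2 := (abs_le.1 (hbound id N)).2
    simp only [id] at h2
    push_cast at h1
    nlinarith [mul_nonneg hβ h0'']
  · have h1 := (abs_le.1 (hbound (N + ·) n)).1
    have h2 : (n : ℝ) ≤ n₀ := by exact_mod_cast (by omega : n ≤ n₀)
    nlinarith [mul_le_mul_of_nonneg_left h2 hβ, mul_nonneg hβ h0]

/-- Continuity from above on one word reaching `q` yields `K`; the Markov property carries it to
every word and time. -/
theorem exists_measure_deviationSet_le_of_state [Finite S]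
    (h : ∀ (u : List S) (σ : S), A.asLimAvg (appendConst u σ) = 1) (q : A.State) (σ : S)
    {δ : ℝ≥0∞} (hδ : δ ≠ 0) :
    ∃ K, ∀ (w : InfWord S) (N m : ℕ), (∀ i < m, w (N + i) = σ) →
      A.runMeasure w ({r | r N = q} ∩ seqShift N ⁻¹' A.deviationSet σ K m) ≤
        δ * A.runMeasure w {r | r N = q} := by
  by_cases hq : ∀ (w : InfWord S) (N : ℕ), A.runMeasure w {r | r N = q} = 0
  · exact ⟨0, fun w N m _ =>
      (measure_mono_null Set.inter_subset_left (hq w N)).trans_le zero_le⟩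
  push Not at hq
  obtain ⟨w₀, M, hM⟩ := hq
  -- A word of the form `u σ^ω`, where the hypothesis applies, that reaches `q` at time `M` as
  -- likely as `w₀` does.
  set v : InfWord S := appendConst (List.ofFn fun i : Fin M => w₀ i) σ with hv
  have hv1 (i : ℕ) (hi : i < M) : w₀ i = v i := by simp [hv, appendConst, hi]
  have hv2 (i : ℕ) : v (M + i) = σ := by simp [hv, appendConst]
  rw [A.runMeasure_congr hv1 (dependsUpTo_state_eq M q)] at hM
  set ρ := A.runMeasure v {r | r M = q} with hρ
  have hρtop : ρ ≠ ∞ := measure_ne_top _ _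
  let D : ℕ → Set (ℕ → A.State) := fun K => seqShift M ⁻¹' ⋃ m, A.deviationSet σ K m
  have hlim : Tendsto (fun K => A.runMeasure v (D K)) atTop (nhds 0) := by
    have hanti : Antitone D := fun K K' hK =>
      Set.preimage_mono (Set.iUnion_mono fun m => A.deviationSet_anti σ m hK)
    have hmeas (K : ℕ) : NullMeasurableSet (D K) (A.runMeasure v) :=
      (measurable_seqShift M (MeasurableSet.iUnion fun m =>
        (A.dependsUpTo_deviationSet σ K m).measurableSet)).nullMeasurableSet
    have hz : A.runMeasure v (⋂ K, D K) = 0 := by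
      rw [measure_eq_zero_iff_ae_notMem]
      filter_upwards [A.ae_exists_notMem_deviationSet hv2 (h _ _)] with r hr hr'
      obtain ⟨K, hK⟩ := hr
      obtain ⟨m, hm⟩ := Set.mem_iUnion.1 (Set.mem_iInter.1 hr' K)
      exact hK m hm
    rw [← hz]
    exact tendsto_measure_iInter_atTop hmeas hanti ⟨0, measure_ne_top _ _⟩
  -- The factor `ρ` turns the bound into one on the probability conditional on being in `q`.
  have hpos : 0 < δ * ρ := ENNReal.mul_pos hδ hM
  obtain ⟨K, hK⟩ := (hlim.eventually_lt_const hpos).exists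
  refine ⟨K, fun w N m hw => ?_⟩
  have hcomp := A.runMeasure_shift_mul_comm q (w := w) (w' := v) (N := N) (N' := M)
    (fun i hi => (hw i hi).trans (hv2 i).symm) (A.dependsUpTo_deviationSet σ K m)
  rw [← ENNReal.mul_le_mul_iff_left hM hρtop, hρ, hcomp, ← hρ, mul_right_comm]
  refine mul_le_mul_left (le_trans (measure_mono ?_) hK.le) _
  exact fun r hr => Set.mem_iUnion.2 ⟨m, hr.2⟩

/-- The shortfall below the average `1 / 2` is bounded with high probability, uniformly in the
word, the starting time and the number of letters read. -/
theorem exists_measure_deviationSet_le [Finite S]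
    (h : ∀ (u : List S) (σ : S), A.asLimAvg (appendConst u σ) = 1)
    {δ : ℝ≥0∞} (hδ : δ ≠ 0) :
    ∃ K, ∀ (σ : S) (w : InfWord S) (N m : ℕ), (∀ i < m, w (N + i) = σ) →
      A.runMeasure w (seqShift N ⁻¹' A.deviationSet σ K m) ≤ δ := by
  -- The largest `K` over states and letters serves all; summing over the state at time `N` removes
  -- the conditioning.
  choose k hk using fun x : A.State × S =>
    A.exists_measure_deviationSet_le_of_state h x.1 x.2 hδ
  obtain ⟨K, hK⟩ := (Set.finite_range k).bddAbove
  have := Fintype.ofFinite A.State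
  refine ⟨K, fun σ w N m hw => ?_⟩
  have hfib (E : Set (ℕ → A.State)) (hE : MeasurableSet E) :
      A.runMeasure w E = ∑ q, A.runMeasure w ({r | r N = q} ∩ E) := by
    rw [← measure_biUnion_finset]
    · congr 1
      ext r
      simp
    · intro q _ q' _ hne
      exact Set.disjoint_left.2 fun r hr hr' => hne (hr.1.symm.trans hr'.1)
    · exact fun q _ => (dependsUpTo_state_eq N q).measurableSet.inter hE
  have hone : ∑ q, A.runMeasure w {r | r N = q} = 1 := by
    have := hfib Set.univ MeasurableSet.univ
    simpa using this.symm
  rw [hfib _ (measurable_seqShift N (A.dependsUpTo_deviationSet σ K m).measurableSet)]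
  calc ∑ q, A.runMeasure w ({r | r N = q} ∩ seqShift N ⁻¹' A.deviationSet σ K m)
      ≤ ∑ q, δ * A.runMeasure w {r | r N = q} := by
        refine sum_le_sum fun q _ => le_trans (measure_mono ?_) (hk (q, σ) w N m hw)
        exact Set.inter_subset_inter_right _
          (Set.preimage_mono (A.deviationSet_anti σ m (hK ⟨(q, σ), rfl⟩)))
    _ = δ := by rw [← mul_sum, hone, mul_one]

end Deviation

end ProbWeightedAutomaton

/-! ### The alternating word and the conclusion -/

/-- A word that is constant on the blocks `[t k, t (k + 1))`. -/
theorem exists_word_of_blocks {S : Type} {t : ℕ → ℕ} (ht0 : t 0 = 0) (ht : StrictMono t)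
    (c : ℕ → S) : ∃ w : InfWord S, ∀ k n, t k ≤ n → n < t (k + 1) → w n = c k := by
  have hex (n : ℕ) : ∃ k, t k ≤ n ∧ n < t (k + 1) := by
    have hn : ∃ k, n < t k := ⟨n + 1, ht.le_apply.trans_lt' n.lt_succ_self⟩
    have h1 := Nat.find_spec hn
    have h2 : Nat.find hn ≠ 0 := fun h => by rw [h, ht0] at h1; omega
    refine ⟨Nat.find hn - 1, not_lt.1 (Nat.find_min hn (by omega)), ?_⟩
    rwa [Nat.sub_add_cancel (by omega)]
  choose κ hκ using hex
  refine ⟨fun n => c (κ n), fun k n h1 h2 => ?_⟩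
  have h3 := ht.lt_iff_lt.1 ((hκ n).1.trans_lt h2)
  have h4 := ht.lt_iff_lt.1 (h1.trans_lt (hκ n).2)
  exact congrArg c (show κ n = k by omega)

theorem exists_word_one_sixth_le_asLimAvg (A : ProbWeightedAutomaton Letter)
    (h : ∀ (u : List Letter) (σ : Letter), A.asLimAvg (appendConst u σ) = 1) :
    ∃ w : InfWord Letter,
      freqLang Letter.a w = 0 ∧ freqLang Letter.b w = 0 ∧ 1 / 6 ≤ A.asLimAvg w := by
  choose K hK using fun k : ℕ => A.exists_measure_deviationSet_le h
    (pow_ne_zero k (ENNReal.inv_ne_zero.2 ENNReal.ofNat_ne_top) : (2⁻¹ : ℝ≥0∞) ^ k ≠ 0)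
  -- `K (k + 1)` is the constant of the block starting at `t (k + 1)`, so that block's shortfall is
  -- small against the time already elapsed.
  let t : ℕ → ℕ := fun k => Nat.rec 0 (fun k x => (k + 2) * (x + K (k + 1) + 1)) k
  have ht (k : ℕ) : t (k + 1) = (k + 2) * (t k + K (k + 1) + 1) := rfl
  have ht' (k : ℕ) : (k + 2) * (t k + 1) ≤ t (k + 1) := by
    rw [ht]; exact Nat.mul_le_mul_left _ (by omega)
  have hlt (k : ℕ) : t k < t (k + 1) := by nlinarith [ht' k, Nat.zero_le (k * t k)]
  obtain ⟨w, hw⟩ := exists_word_of_blocks rfl (strictMono_nat_of_lt_succ hlt)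
    fun k => if Even k then Letter.a else Letter.b
  refine ⟨w, freqLang_eq_zero_of_blocks ht' ?_, freqLang_eq_zero_of_blocks ht' ?_,
    A.le_asLimAvg ?_⟩
  · refine frequently_atTop.2 fun N => ⟨2 * N + 1, by omega, fun n h1 h2 => ?_⟩
    rw [hw _ n h1 h2, if_neg (by simp)]
    decide
  · refine frequently_atTop.2 fun N => ⟨2 * N, by omega, fun n h1 h2 => ?_⟩
    rw [hw _ n h1 h2, if_pos (by simp)]
    decide
  · obtain ⟨β, hβ, hwt⟩ := A.exists_abs_weight_le
    have hword (k i : ℕ) (hi : i < t (k + 1) - t k) :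
        w (t k + i) = if Even k then Letter.a else Letter.b :=
      hw k _ (by omega) (by omega)
    have hsum : ∑' k, A.runMeasure w (seqShift (t k) ⁻¹'
        A.deviationSet (if Even k then Letter.a else Letter.b) (K k) (t (k + 1) - t k)) ≠ ∞ := by
      refine ne_top_of_le_ne_top ?_
        (ENNReal.tsum_le_tsum fun k => hK k _ w (t k) (t (k + 1) - t k) (hword k))
      rw [ENNReal.tsum_geometric]
      simp
    -- Borel–Cantelli; no independence of the blocks is needed.
    filter_upwards [ae_eventually_notMem hsum] with r hr
    refine one_sixth_le_limAvg_of_blocks (fun i => hwt _ _ _) hβ ht ?_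
    filter_upwards [hr] with k hk n hn
    by_contra hcon
    refine hk ⟨n, hn, ?_⟩
    rw [not_le] at hcon
    refine lt_of_eq_of_lt ?_ hcon
    congr 1
    refine sum_congr rfl fun i hi => ?_
    rw [ProbWeightedAutomaton.weights, hword k i ((mem_range.1 hi).trans_le hn)]
    rfl

theorem not_isAsLimAvg_freqLang_add :
    ¬ IsAsLimAvg (freqLang Letter.a + freqLang Letter.b) := by
  rintro ⟨A, hA⟩
  obtain ⟨w, ha, hb, hw⟩ := exists_word_one_sixth_le_asLimAvg A fun u σ => by
    rw [hA, freqLang_add_appendConst]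
  rw [hA, Pi.add_apply, ha, hb] at hw
  norm_num at hw

theorem mainTheorem8 :
    -- both frequency languages are definable, already by deterministic automata
    (IsDLimAvg (freqLang Letter.a) ∧ IsDLimAvg (freqLang Letter.b)) ∧
    (IsAsLimAvg (freqLang Letter.a) ∧ IsAsLimAvg (freqLang Letter.b)) ∧
    -- their sum is not
    ¬ IsAsLimAvg (freqLang Letter.a + freqLang Letter.b) ∧
    -- hence the class is not closed under sum
    ¬ ClosedUnderSum @IsAsLimAvg ∧
    -- an automaton that is right on all words `u a a a …` and `u b b b …` fails as follows
    (∀ A : ProbWeightedAutomaton Letter,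
      (∀ (u : List Letter) (σ : Letter), A.asLimAvg (appendConst u σ) = 1) →
      ∃ w : InfWord Letter,
        freqLang Letter.a w = 0 ∧ freqLang Letter.b w = 0 ∧ 1 / 6 ≤ A.asLimAvg w) := by
  exact ⟨⟨isDLimAvg_freqLang _, isDLimAvg_freqLang _⟩,
    ⟨isAsLimAvg_freqLang _, isAsLimAvg_freqLang _⟩, not_isAsLimAvg_freqLang_add,
    fun h => not_isAsLimAvg_freqLang_add
      (h Letter _ _ (isAsLimAvg_freqLang _) (isAsLimAvg_freqLang _)),
    exists_word_one_sixth_le_asLimAvg⟩
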